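/- Let $\mathcal F^2$ be the Fock space of entire functions $f$ with $\frac1\pi\int_{\mathbb C}|f(z)|^2e^{-|z|^2}\,dV(z)<\infty$ ($dV$ is Lebesgue measure on $\mathbb C$), with inner product $\langle f,g\rangle=\frac1\pi\int_{\mathbb C}f(z)\overline{g(z)}e^{-|z|^2}\,dV(z)$. A multi-valued linear operator $T$ on $\mathcal F^2$ is identified with its graph $G(T)$, a linear subspace of $\mathcal F^2\times\mathcal F^2$, and its adjoint $T^*$ is the multi-valued operator with graph $$G(T^*)=\{(u,v)\in\mathcal F^2\times\mathcal F^2:\ \langle g,u\rangle=\langle f,v\rangle\ \text{ for all }(f,g)\in G(T)\}.$$ Let $m\ge 0$ be an integer and let $a,b,c\in\mathbb C$ satisfy $|a|=1$, $\bar a b+\bar b=0$ and $|c|^2e^{|b|^2}=1$. Let $A,B,C,D\in\mathbb C$ with $C\neq0$, and suppose that $A\ne 0$ or $m=0$. Let $\mathbf S_{\max}$ be the maximal multi-valued weighted composition operator with symbols $\psi(z)=Ce^{Dz}$, $\varphi(z)=Az+B$, $\phi(z)=(aAz+aB+b)^m$, that is, the multi-valued operator whose graph consists of all pairs $(f,g)\in\mathcal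 F^2\times\mathcal F^2$ with $$Ce^{Dz}f(Az+B)=(aAz+aB+b)^m\,g^{(m)}(z)\qquad\text{for all }z\in\mathbb C.$$ Then $\mathbf S_{\max}^*=\widehat{\mathbf S}_{\max}$, where $\widehat{\mathbf S}_{\max}$ is the multi-valued operator whose graph consists of all pairs $(f,g)\in\mathcal F^2\times\mathcal F^2$ with $$\overline C e^{\overline B z}f(\overline A z+\overline D)=(\overline A z+\overline D)^m\sum_{j=0}^m\binom mj\bar a^{\,j}\,\bar b^{\,m-j}g^{(j)}(z)\qquad\text{for all }z\in\mathbb C.$$ -/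

import Mathlib

open scoped ComplexConjugate
open MeasureTheory

noncomputable section

/-- `f` is an entire function that is square integrable for the Gaussian weight. -/
def IsFock (f : ℂ → ℂ) : Prop :=
  Differentiable ℂ f ∧ Integrable (fun z : ℂ => ‖f z‖ ^ 2 * Real.exp (-‖z‖ ^ 2)) volume

theorem IsFock.integrable_mul {f g : ℂ → ℂ} (hf : IsFock f) (hg : IsFock g) :
    Integrable (fun z : ℂ => f z * conj (g z) * (Real.exp (-‖z‖ ^ 2) : ℂ)) volume := by
  have hfc := hf.1.continuous
  have hgc := hg.1.continuous
  refine (hf.2.add hg.2).mono' (Continuous.aestronglyMeasurable (by fun_prop)) ?_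
  refine Filter.Eventually.of_forall fun z => ?_
  have he : ‖(Real.exp (-‖z‖ ^ 2) : ℂ)‖ = Real.exp (-‖z‖ ^ 2) := by
    rw [Complex.norm_real, Real.norm_of_nonneg (Real.exp_pos _).le]
  simp only [norm_mul, he, RCLike.norm_conj, Pi.add_apply]
  rw [← add_mul]
  refine mul_le_mul_of_nonneg_right ?_ (Real.exp_pos _).le
  nlinarith [sq_nonneg (‖f z‖ - ‖g z‖), sq_nonneg ‖f z‖, sq_nonneg ‖g z‖]

theorem IsFock.add {f g : ℂ → ℂ} (hf : IsFock f) (hg : IsFock g) : IsFock (f + g) := by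
  refine ⟨hf.1.add hg.1, ?_⟩
  have hfc := hf.1.continuous
  have hgc := hg.1.continuous
  refine ((hf.2.add hg.2).const_mul 2).mono' (Continuous.aestronglyMeasurable (by fun_prop)) ?_
  refine Filter.Eventually.of_forall fun z => ?_
  rw [Real.norm_of_nonneg (by positivity)]
  simp only [Pi.add_apply]
  rw [← add_mul, ← mul_assoc]
  refine mul_le_mul_of_nonneg_right ?_ (Real.exp_pos _).le
  have h := norm_add_le (f z) (g z)
  nlinarith [sq_nonneg (‖f z‖ - ‖g z‖), norm_nonneg (f z + g z), norm_nonneg (f z),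
    norm_nonneg (g z)]

theorem IsFock.smul {f : ℂ → ℂ} (c : ℂ) (hf : IsFock f) : IsFock (c • f) := by
  refine ⟨hf.1.const_smul c, ?_⟩
  refine (hf.2.const_mul (‖c‖ ^ 2)).congr (Filter.Eventually.of_forall fun z => ?_)
  simp only [Pi.smul_apply, smul_eq_mul, norm_mul]
  ring

theorem IsFock.zero : IsFock 0 := by
  refine ⟨differentiable_const 0, ?_⟩
  simp

/-- The linear space of entire functions underlying the Fock space. -/
def fockSubmodule : Submodule ℂ (ℂ → ℂ) where
  carrier := {f | IsFock f}
  add_mem' hf hg := hf.add hg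
  zero_mem' := IsFock.zero
  smul_mem' c _ hf := hf.smul c

/-- The Fock (Segal-Bargmann) space. It is kept as a type of its own, so that its topology is the
one of the norm below and not the topology of pointwise convergence. -/
def FockSpace : Type := fockSubmodule

namespace FockSpace

instance : AddCommGroup FockSpace := inferInstanceAs (AddCommGroup fockSubmodule)

instance : Module ℂ FockSpace := inferInstanceAs (Module ℂ fockSubmodule)

instance : CoeFun FockSpace (fun _ => ℂ → ℂ) := ⟨fun f => f.1⟩

theorem isFock (f : FockSpace) : IsFock f := f.2

theorem ext {f g : FockSpace} (h : ∀ z, f z = g z) : f = g := Subtype.ext (funext h)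

@[simp] theorem add_apply (f g : FockSpace) (z : ℂ) : (f + g) z = f z + g z := rfl

@[simp] theorem smul_apply (c : ℂ) (f : FockSpace) (z : ℂ) : (c • f) z = c * f z := rfl

@[simp] theorem zero_apply (z : ℂ) : (0 : FockSpace) z = 0 := rfl

/-- `⟨f, g⟩ = π⁻¹ ∫ f(z) conj(g(z)) exp(-|z|²) dV(z)`, linear in `f`, conjugate linear in `g`. -/
def pairing (f g : FockSpace) : ℂ :=
  (Real.pi : ℂ)⁻¹ * ∫ z : ℂ, f z * conj (g z) * (Real.exp (-‖z‖ ^ 2) : ℂ)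

theorem pairing_self (f : FockSpace) :
    pairing f f = ((Real.pi⁻¹ * ∫ z : ℂ, ‖f z‖ ^ 2 * Real.exp (-‖z‖ ^ 2) : ℝ) : ℂ) := by
  unfold pairing
  push_cast
  rw [← integral_complex_ofReal]
  congr 1
  refine integral_congr_ae (Filter.Eventually.of_forall fun z => ?_)
  simp only [Complex.mul_conj, Complex.normSq_eq_norm_sq]
  push_cast
  ring

/-- Mathlib's inner products are conjugate linear in the first variable, hence the swap. -/
@[reducible] def core : InnerProductSpace.Core ℂ FockSpace where
  inner f g := pairing g f
  conj_inner_symm f g := by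
    simp only [pairing, map_mul, map_inv₀, Complex.conj_ofReal, ← integral_conj]
    congr 1
    refine integral_congr_ae (Filter.Eventually.of_forall fun z => ?_)
    simp only [map_mul, Complex.conj_conj, Complex.conj_ofReal]
    ring
  re_inner_nonneg f := by
    rw [pairing_self]
    simp only [RCLike.re_to_complex, Complex.ofReal_re]
    have := integral_nonneg (μ := (volume : Measure ℂ))
      (f := fun z : ℂ => ‖f z‖ ^ 2 * Real.exp (-‖z‖ ^ 2)) (fun z => by positivity)
    have hpi := Real.pi_pos
    positivity
  add_left f g h := by
    simp only [pairing, add_apply, map_add, mul_add, add_mul]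
    rw [integral_add (h.isFock.integrable_mul f.isFock) (h.isFock.integrable_mul g.isFock), mul_add]
  smul_left f g r := by
    simp only [pairing, smul_apply, map_mul]
    rw [mul_left_comm, ← integral_const_mul (conj r)]
    congr 2
    funext z
    ring
  definite f hf := by
    rw [pairing_self] at hf
    have h0 : ∫ z : ℂ, ‖f z‖ ^ 2 * Real.exp (-‖z‖ ^ 2) = 0 := by
      have := Complex.ofReal_eq_zero.mp hf
      rcases mul_eq_zero.mp this with h | h
      · exact absurd h (inv_ne_zero Real.pi_ne_zero)
      · exact h
    rw [integral_eq_zero_iff_of_nonneg (fun z => by positivity) f.isFock.2] at h0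
    have hc := f.isFock.1.continuous
    have h1 := (Continuous.ae_eq_iff_eq volume (by fun_prop) continuous_zero).mp h0
    refine ext fun z => ?_
    have h2 := congrFun h1 z
    simp only [Pi.zero_apply, mul_eq_zero, Real.exp_ne_zero, or_false] at h2
    simpa using h2

instance : NormedAddCommGroup FockSpace := core.toNormedAddCommGroup

instance : InnerProductSpace ℂ FockSpace := InnerProductSpace.ofCore core.toCore

theorem inner_eq (f g : FockSpace) : inner ℂ f g = pairing g f := rfl

theorem contDiff (f : FockSpace) (n : ℕ) (z : ℂ) : ContDiffAt ℂ n f z :=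
  f.isFock.1.contDiff.contDiffAt

theorem iteratedDeriv_add (f g : FockSpace) (n : ℕ) (z : ℂ) :
    iteratedDeriv n (f + g : FockSpace) z = iteratedDeriv n f z + iteratedDeriv n g z :=
  _root_.iteratedDeriv_add (f.contDiff n z) (g.contDiff n z)

theorem iteratedDeriv_smul (c : ℂ) (f : FockSpace) (n : ℕ) (z : ℂ) :
    iteratedDeriv n (c • f : FockSpace) z = c * iteratedDeriv n f z :=
  iteratedDeriv_const_mul_field c f

theorem iteratedDeriv_zero (n : ℕ) (z : ℂ) : iteratedDeriv n (0 : FockSpace) z = 0 := by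
  have h := iteratedDeriv_smul 0 0 n z
  rwa [zero_smul, zero_mul] at h

end FockSpace

/-- A multi-valued linear operator in the Fock space, given by its graph: its domain is the set of
`f` with `(f, g)` in the graph for some `g`, and its value at such an `f` is the set of all these
`g`. The adjoint of `T` is Mathlib's `Submodule.adjoint T`, whose members are the pairs `(u, v)`
with `⟨g, u⟩ = ⟨f, v⟩` for all `(f, g)` in `T`. -/
abbrev MultiOp : Type := Submodule ℂ (FockSpace × FockSpace)

theorem MultiOp.mem_adjoint_iff (T : MultiOp) (u v : FockSpace) :
    (u, v) ∈ T.adjoint ↔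
      ∀ f g : FockSpace, (f, g) ∈ T → FockSpace.pairing g u = FockSpace.pairing f v := by
  rw [Submodule.mem_adjoint_iff]
  refine forall_congr' fun f => forall_congr' fun g => imp_congr_right fun _ => ?_
  rw [sub_eq_zero, ← inner_conj_symm g u, ← inner_conj_symm f v]
  exact (starRingEnd ℂ).injective.eq_iff

/-- The maximal multi-valued weighted composition operator induced by the equation
`ψ · (f ∘ φ) = ϕ · g⁽ᵐ⁾`: its graph consists of all pairs in the Fock space that satisfy it. -/
def maxMultiWCO (ψ φ ϕ : ℂ → ℂ) (m : ℕ) : MultiOp where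
  carrier := {p | ∀ z : ℂ, ψ z * p.1 (φ z) = ϕ z * iteratedDeriv m p.2 z}
  add_mem' {p q} hp hq z := by
    simp only [Prod.fst_add, Prod.snd_add, FockSpace.add_apply, FockSpace.iteratedDeriv_add,
      mul_add, hp z, hq z]
  zero_mem' z := by simp [FockSpace.iteratedDeriv_zero]
  smul_mem' c p hp z := by
    simp only [Prod.smul_fst, Prod.smul_snd, FockSpace.smul_apply, FockSpace.iteratedDeriv_smul]
    rw [mul_left_comm, hp z, mul_left_comm]

/-- The maximal multi-valued operator induced by the equation
`ψ · (f ∘ φ) = ϕ · ∑ j ≤ m, (m choose j) α ^ j β ^ (m - j) g⁽ʲ⁾`: its graph consists of all pairs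
in the Fock space that satisfy it. -/
def maxMultiWCOBinom (ψ φ ϕ : ℂ → ℂ) (m : ℕ) (α β : ℂ) : MultiOp where
  carrier := {p | ∀ z : ℂ, ψ z * p.1 (φ z) =
    ϕ z * ∑ j ∈ Finset.range (m + 1),
      (m.choose j : ℂ) * α ^ j * β ^ (m - j) * iteratedDeriv j p.2 z}
  add_mem' {p q} hp hq z := by
    simp only [Prod.fst_add, Prod.snd_add, FockSpace.add_apply, FockSpace.iteratedDeriv_add,
      mul_add, hp z, hq z, Finset.sum_add_distrib]
  zero_mem' z := by simp [FockSpace.iteratedDeriv_zero]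
  smul_mem' c p hp z := by
    simp only [Prod.smul_fst, Prod.smul_snd, FockSpace.smul_apply, FockSpace.iteratedDeriv_smul]
    rw [mul_left_comm, hp z, mul_left_comm, Finset.mul_sum]
    congr 1
    exact Finset.sum_congr rfl fun j _ => by ring

end

/-! ### Gaussian pairing, growth bounds and termwise pairing. -/

noncomputable section

open Filter Topology

/-! The conditions on `a` and `b` say that the symbol `aAz + aB + b` equals `a (w - q)` with `w = Az
+ B` and `q = conj b`. Everything is therefore centred at `q` on the side of `f`.

The inclusion of the adjoint in the binomial operator is a test against kernels. For each `β` the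
graph contains the pair with `f = (D + Aβ)^m (w - q)^m e^{βw}` and `g` a suitable multiple of `e^{(D
+ Aβ)z}`. By the reproducing property and its derivatives, the adjoint relation on this pair is
exactly the binomial equation at the point `conj β` (`binom_relation_iff`).

The converse must reach every pair `(f, g)` of the maximal graph, and no density of the kernel pairs
is known. For `A ≠ 0` let `Ap + B = q` and `δ = D/A`. The graph equation relates the Taylor
coefficients of `g` at `p` to those of `e^{δ(z-q)} f` at `q`. The binomial equation for `(u, v)`,
expanded in powers of `s = D + Aβ`, relates the moments of `u` against `(z-p)^n` to those of `v`
against `(z-q)^n e^{-δz}`. Together they give `⟨g, u⟩ = ⟨f, v⟩` term by term in the two expansions.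

At full size these expansions have critical Gaussian growth, so pairing termwise is not justified by
domination. Replacing `f` and `g` by dilations of the same ratio `r < 1` multiplies the `n`-th terms
on both sides by `r^n`, which preserves their equality and makes the growth subcritical
(`hasSum_gaussPair_dilate`). The dilations are bounded in norm and converge pointwise, hence weakly,
as `r → 1` (`tendsto_gaussPair_dilate`). If `A = 0` and `m = 0`, both operators are explicit and of
rank at most one. -/

/-- The Gaussian pairing `∫ f conj(g) exp(-|z|²)`, without the normalising factor. -/
def gaussPair (f g : ℂ → ℂ) : ℂ :=
  ∫ z : ℂ, f z * conj (g z) * (Real.exp (-‖z‖ ^ 2) : ℂ)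

theorem FockSpace.pairing_eq_iff (f g u v : FockSpace) :
    FockSpace.pairing g u = FockSpace.pairing f v ↔ gaussPair g u = gaussPair f v := by
  unfold FockSpace.pairing gaussPair
  have h : (Real.pi : ℂ)⁻¹ ≠ 0 := inv_ne_zero (by exact_mod_cast Real.pi_ne_zero)
  exact mul_right_inj' h

theorem gaussPair_conj (f g : ℂ → ℂ) : conj (gaussPair f g) = gaussPair g f := by
  unfold gaussPair
  rw [← integral_conj]
  refine integral_congr_ae (Eventually.of_forall fun z => ?_)
  simp only [map_mul, Complex.conj_conj, Complex.conj_ofReal]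
  ring

theorem gaussPair_const_mul (c : ℂ) (f g : ℂ → ℂ) :
    gaussPair (fun z => c * f z) g = c * gaussPair f g := by
  unfold gaussPair
  rw [← integral_const_mul]
  congr 1
  funext z
  ring

theorem integrable_exp_neg_mul_norm_sq {ε : ℝ} (hε : 0 < ε) :
    Integrable (fun z : ℂ => Real.exp (-ε * ‖z‖ ^ 2)) := by
  have h := (GaussianFourier.integrable_cexp_neg_mul_sq_norm_add (V := ℂ) (b := (ε : ℂ))
    (by simpa using hε) 0 0).norm
  refine h.congr (Eventually.of_forall fun z => ?_)
  simp only [Complex.norm_exp]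
  congr 1
  simp [← Complex.ofReal_pow]

theorem integral_exp_neg_sq : ∫ z : ℂ, (Real.exp (-‖z‖ ^ 2) : ℂ) = Real.pi := by
  have h := GaussianFourier.integral_rexp_neg_mul_sq_norm (V := ℂ) (b := 1) one_pos
  rw [integral_complex_ofReal]
  simp only [neg_mul, one_mul, Complex.finrank_real_complex] at h
  rw [h]
  norm_num

/-- Strictly subcritical Gaussian growth. -/
def GaussBound (h : ℂ → ℝ) : Prop :=
  ∃ K σ : ℝ, 0 ≤ K ∧ σ < 1 ∧ ∀ z, h z ≤ K * Real.exp (σ / 2 * ‖z‖ ^ 2)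

theorem GaussBound.mono {h k : ℂ → ℝ} (hk : GaussBound k) (hle : ∀ z, h z ≤ k z) :
    GaussBound h := by
  obtain ⟨K, σ, hK, hσ, hb⟩ := hk
  exact ⟨K, σ, hK, hσ, fun z => (hle z).trans (hb z)⟩

/-- A linear exponent is absorbed by half of the gap `1 - s`: completing the square costs the
constant `τ² / (1 - s)`. -/
theorem gaussBound_exp {K s τ κ : ℝ} (hK : 0 ≤ K) (hs : s < 1) :
    GaussBound (fun z => K * Real.exp (s / 2 * ‖z‖ ^ 2 + τ * ‖z‖ + κ)) := by
  refine ⟨K * Real.exp (τ ^ 2 / (1 - s) + κ), (1 + s) / 2, by positivity, by linarith,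
    fun z => ?_⟩
  rw [mul_assoc, ← Real.exp_add]
  refine mul_le_mul_of_nonneg_left (Real.exp_le_exp.mpr ?_) hK
  have h1 : 0 < 1 - s := by linarith
  have h2 : τ * ‖z‖ ≤ (1 - s) / 4 * ‖z‖ ^ 2 + τ ^ 2 / (1 - s) := by
    have h3 : (1 - s) / 4 * ‖z‖ ^ 2 + τ ^ 2 / (1 - s) - τ * ‖z‖ =
        ((1 - s) / 2 * ‖z‖ - τ) ^ 2 / (1 - s) := by
      field_simp
      ring
    have h4 : 0 ≤ ((1 - s) / 2 * ‖z‖ - τ) ^ 2 / (1 - s) := by positivity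
    linarith
  nlinarith

theorem GaussBound.isFock {h : ℂ → ℂ} (hd : Differentiable ℂ h)
    (hb : GaussBound (fun z => ‖h z‖)) : IsFock h := by
  obtain ⟨K, σ, hK, hσ, hb⟩ := hb
  refine ⟨hd, ?_⟩
  have hc := hd.continuous
  refine ((integrable_exp_neg_mul_norm_sq (ε := 1 - σ) (by linarith)).const_mul (K ^ 2)).mono'
    (Continuous.aestronglyMeasurable (by fun_prop)) (Eventually.of_forall fun z => ?_)
  rw [Real.norm_of_nonneg (by positivity)]
  calc ‖h z‖ ^ 2 * Real.exp (-‖z‖ ^ 2)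
      ≤ (K * Real.exp (σ / 2 * ‖z‖ ^ 2)) ^ 2 * Real.exp (-‖z‖ ^ 2) := by
        gcongr
        exact hb z
    _ = K ^ 2 * Real.exp (-(1 - σ) * ‖z‖ ^ 2) := by
        rw [mul_pow, mul_assoc, ← Real.exp_nat_mul, ← Real.exp_add]
        congr 2
        push_cast
        ring

theorem integrable_gaussBound_mul {u : ℂ → ℂ} (hu : IsFock u) (K : ℝ) {σ : ℝ} (hσ : σ < 1) :
    Integrable (fun z : ℂ => K * Real.exp (σ / 2 * ‖z‖ ^ 2) * ‖u z‖ * Real.exp (-‖z‖ ^ 2)) := by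
  have hc := hu.1.continuous
  refine (((integrable_exp_neg_mul_norm_sq (ε := 1 - σ) (by linarith)).const_mul (K ^ 2)).add
    hu.2).mono' (Continuous.aestronglyMeasurable (by fun_prop)) (Eventually.of_forall fun z => ?_)
  have h1 : K ^ 2 * Real.exp (-(1 - σ) * ‖z‖ ^ 2) =
      (K * Real.exp (σ / 2 * ‖z‖ ^ 2)) ^ 2 * Real.exp (-‖z‖ ^ 2) := by
    rw [mul_pow, mul_assoc, ← Real.exp_nat_mul, ← Real.exp_add]
    congr 2
    push_cast
    ring
  simp only [Pi.add_apply]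
  rw [h1, ← add_mul, norm_mul, Real.norm_of_nonneg (Real.exp_pos (-‖z‖ ^ 2)).le, Real.norm_eq_abs]
  refine mul_le_mul_of_nonneg_right ?_ (Real.exp_pos _).le
  rw [abs_le]
  constructor <;>
  nlinarith [sq_nonneg (K * Real.exp (σ / 2 * ‖z‖ ^ 2) - ‖u z‖),
    sq_nonneg (K * Real.exp (σ / 2 * ‖z‖ ^ 2) + ‖u z‖),
    sq_nonneg (K * Real.exp (σ / 2 * ‖z‖ ^ 2)), sq_nonneg ‖u z‖]

theorem norm_exp_neg_sq (z : ℂ) : ‖(Real.exp (-‖z‖ ^ 2) : ℂ)‖ = Real.exp (-‖z‖ ^ 2) := by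
  rw [Complex.norm_real, Real.norm_of_nonneg (Real.exp_pos _).le]

/-- Termwise pairing of a series dominated by a subcritical Gaussian. -/
theorem hasSum_gaussPair {h : ℕ → ℂ → ℂ} {u H : ℂ → ℂ} (hu : IsFock u)
    (hc : ∀ n, Continuous (h n)) (hs : ∀ z, Summable fun n => ‖h n z‖)
    (hb : GaussBound (fun z => ∑' n, ‖h n z‖)) (hH : ∀ z, HasSum (fun n => h n z) (H z)) :
    HasSum (fun n => gaussPair (h n) u) (gaussPair H u) := by
  obtain ⟨K, σ, hK, hσ, hb⟩ := hb
  have huc := hu.1.continuous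
  have hint := integrable_gaussBound_mul hu K hσ
  have hle : ∀ (s : Finset ℕ) (z : ℂ),
      ‖∑ n ∈ s, h n z‖ ≤ K * Real.exp (σ / 2 * ‖z‖ ^ 2) := fun s z =>
    (norm_sum_le _ _).trans (((hs z).sum_le_tsum s fun _ _ => norm_nonneg _).trans (hb z))
  have hle1 : ∀ (n : ℕ) (z : ℂ), ‖h n z‖ ≤ K * Real.exp (σ / 2 * ‖z‖ ^ 2) := fun n z => by
    simpa using hle {n} z
  have hin : ∀ n, Integrable (fun z => h n z * conj (u z) * (Real.exp (-‖z‖ ^ 2) : ℂ)) := by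
    intro n
    have := hc n
    refine hint.mono' (Continuous.aestronglyMeasurable (by fun_prop))
      (Eventually.of_forall fun z => ?_)
    rw [norm_mul, norm_mul, norm_exp_neg_sq, RCLike.norm_conj]
    gcongr
    exact hle1 n z
  unfold HasSum
  have hsum : ∀ s : Finset ℕ, ∑ n ∈ s, gaussPair (h n) u =
      ∫ z : ℂ, (∑ n ∈ s, h n z) * conj (u z) * (Real.exp (-‖z‖ ^ 2) : ℂ) := by
    intro s
    unfold gaussPair
    rw [← integral_finsetSum s fun n _ => hin n]
    simp only [Finset.sum_mul]
  simp only [hsum, SummationFilter.unconditional_filter]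
  refine tendsto_integral_filter_of_dominated_convergence
    (fun z : ℂ => K * Real.exp (σ / 2 * ‖z‖ ^ 2) * ‖u z‖ * Real.exp (-‖z‖ ^ 2))
    (Eventually.of_forall fun s => ?_)
    (Eventually.of_forall fun s => Eventually.of_forall fun z => ?_) hint
    (Eventually.of_forall fun z => ?_)
  · refine Continuous.aestronglyMeasurable ?_
    have : Continuous fun z => ∑ n ∈ s, h n z := continuous_finsetSum s fun n _ => hc n
    fun_prop
  · rw [norm_mul, norm_mul, norm_exp_neg_sq, RCLike.norm_conj]
    gcongr
    exact hle s z
  · have h1 := hH z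
    unfold HasSum at h1
    rw [SummationFilter.unconditional_filter] at h1
    exact (h1.mul_const _).mul_const _

/-! ### Reproducing property of the exponentials and pointwise bounds. -/

/-- Mean value property with respect to the Gaussian measure. -/
theorem integral_entire_mul_gauss {h : ℂ → ℂ} (hd : Differentiable ℂ h)
    (hi : Integrable (fun z => h z * (Real.exp (-‖z‖ ^ 2) : ℂ))) :
    ∫ z : ℂ, h z * (Real.exp (-‖z‖ ^ 2) : ℂ) = Real.pi * h 0 := by
  have hc := hd.continuous
  set F : ℂ → ℂ := fun z => h z * (Real.exp (-‖z‖ ^ 2) : ℂ) with hF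
  -- The Gaussian measure is rotation invariant, so the integral equals its average over rotations.
  -- After Fubini the inner average of `h` over a circle centred at `0` is `h 0`.
  have hrot : ∀ (θ : ℝ) (z : ℂ), rotation (Circle.exp θ) z = Complex.exp (θ * Complex.I) * z := by
    intro θ z
    simp
  have hmp : ∀ θ : ℝ, MeasurePreserving (fun z => Complex.exp (θ * Complex.I) * z)
      (volume : Measure ℂ) volume := by
    intro θ
    have := (rotation (Circle.exp θ)).measurePreserving
    simpa only [funext (hrot θ)] using this
  have hme : ∀ θ : ℝ, MeasurableEmbedding (fun z => Complex.exp (θ * Complex.I) * z) := by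
    intro θ
    have := (rotation (Circle.exp θ)).toHomeomorph.measurableEmbedding
    have h2 : ⇑(rotation (Circle.exp θ)).toHomeomorph =
      fun z => Complex.exp (θ * Complex.I) * z := funext (hrot θ)
    rwa [h2] at this
  have hFc : Continuous F := by
    rw [hF]
    fun_prop
  have hval : ∀ (θ : ℝ), ∫ z, F (Complex.exp (θ * Complex.I) * z) = ∫ z, F z := fun θ =>
    (hmp θ).integral_comp (hme θ) F
  have hvaln : ∀ (θ : ℝ), ∫ z, ‖F (Complex.exp (θ * Complex.I) * z)‖ = ∫ z, ‖F z‖ := fun θ =>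
    (hmp θ).integral_comp (hme θ) fun z => ‖F z‖
  have hprod : Integrable (fun q : ℝ × ℂ => F (Complex.exp (q.1 * Complex.I) * q.2))
      ((volume.restrict (Set.uIoc 0 (2 * Real.pi))).prod volume) := by
    rw [integrable_prod_iff (Continuous.aestronglyMeasurable (by fun_prop))]
    refine ⟨Eventually.of_forall fun θ => (hmp θ).integrable_comp_of_integrable hi, ?_⟩
    simp only [hvaln]
    have : IsFiniteMeasure ((volume : Measure ℝ).restrict (Set.uIoc 0 (2 * Real.pi))) :=
      isFiniteMeasure_restrict.mpr (by simp [Set.uIoc])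
    exact integrable_const _
  have h1 : ∫ θ in (0 : ℝ)..2 * Real.pi, ∫ z, F (Complex.exp (θ * Complex.I) * z) =
      ∫ z, ∫ θ in (0 : ℝ)..2 * Real.pi, F (Complex.exp (θ * Complex.I) * z) :=
    intervalIntegral_integral_swap hprod
  have h2 : ∀ z, ∫ θ in (0 : ℝ)..2 * Real.pi, F (Complex.exp (θ * Complex.I) * z) =
      2 * Real.pi * (h 0 * (Real.exp (-‖z‖ ^ 2) : ℂ)) := by
    intro z
    have h3 := DiffContOnCl.circleAverage (f := fun x => h (x * z)) (c := 0) (R := 1)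
      (Differentiable.diffContOnCl (by fun_prop))
    rw [Real.circleAverage_def] at h3
    have h4 : ∫ θ in (0 : ℝ)..2 * Real.pi, h (Complex.exp (θ * Complex.I) * z) =
        2 * Real.pi * h 0 := by
      simp only [circleMap, zero_mul, zero_add, Complex.ofReal_one, one_mul] at h3
      have hpi : ((2 * Real.pi : ℝ) : ℂ) ≠ 0 := by
        exact_mod_cast mul_ne_zero two_ne_zero Real.pi_ne_zero
      rw [← h3, Complex.real_smul, Complex.ofReal_inv, ← Complex.ofReal_ofNat,
        ← Complex.ofReal_mul, mul_inv_cancel_left₀ hpi]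
    simp only [hF, norm_mul, Complex.norm_exp_ofReal_mul_I, one_mul]
    rw [intervalIntegral.integral_mul_const, h4]
    ring
  simp only [hval, h2, integral_const_mul, integral_exp_neg_sq, intervalIntegral.integral_const,
    Complex.real_smul] at h1
  have hpi : (2 * Real.pi : ℂ) ≠ 0 := by
    have : (Real.pi : ℂ) ≠ 0 := by exact_mod_cast Real.pi_ne_zero
    simp
  apply mul_left_cancel₀ hpi
  push_cast at h1
  rw [sub_zero] at h1
  rw [h1]
  ring

theorem isFock_pow_mul_exp (n : ℕ) (q β : ℂ) :
    IsFock (fun z => (z - q) ^ n * Complex.exp (β * z)) := by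
  refine GaussBound.isFock (by fun_prop) ((gaussBound_exp (K := n.factorial) (s := 0)
    (τ := 1 + ‖β‖) (κ := ‖q‖) (by positivity) (by norm_num)).mono fun z => ?_)
  rw [norm_mul, norm_pow, Complex.norm_exp]
  have h1 : ‖z - q‖ ^ n ≤ n.factorial * Real.exp ‖z - q‖ := by
    have := Real.pow_div_factorial_le_exp ‖z - q‖ (norm_nonneg _) n
    rw [div_le_iff₀ (by positivity)] at this
    linarith
  have h2 : (β * z).re ≤ ‖β‖ * ‖z‖ := (Complex.re_le_norm _).trans (norm_mul _ _).le
  have h3 := norm_sub_le z q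
  calc ‖z - q‖ ^ n * Real.exp (β * z).re
      ≤ (n.factorial * Real.exp ‖z - q‖) * Real.exp (‖β‖ * ‖z‖) := by gcongr
    _ = n.factorial * Real.exp (‖z - q‖ + ‖β‖ * ‖z‖) := by rw [mul_assoc, ← Real.exp_add]
    _ ≤ _ := mul_le_mul_of_nonneg_left (Real.exp_le_exp.mpr (by linarith)) (by positivity)

theorem isFock_exp (β : ℂ) : IsFock (fun z => Complex.exp (β * z)) := by
  simpa using isFock_pow_mul_exp 0 0 β

/-- The reproducing property of the kernel functions. -/
theorem gaussPair_exp {f : ℂ → ℂ} (hf : IsFock f) (β : ℂ) :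
    gaussPair f (fun z => Complex.exp (β * z)) = Real.pi * f (conj β) := by
  have hi := hf.integrable_mul (isFock_exp β)
  have hd := hf.1
  -- Translation by `conj β` completes the square: conjugated kernel times weight becomes the entire
  -- factor `exp (-βz)` times the weight, and the mean value property applies.
  have key : ∀ z, f (z + conj β) * conj (Complex.exp (β * (z + conj β))) *
      (Real.exp (-‖z + conj β‖ ^ 2) : ℂ) =
      (f (z + conj β) * Complex.exp (-(β * z))) * (Real.exp (-‖z‖ ^ 2) : ℂ) := by
    intro z
    rw [← Complex.exp_conj, mul_assoc, mul_assoc, Complex.ofReal_exp, Complex.ofReal_exp,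
      ← Complex.exp_add, ← Complex.exp_add]
    congr 2
    push_cast
    rw [← Complex.mul_conj', ← Complex.mul_conj']
    simp only [map_mul, map_add, Complex.conj_conj]
    ring
  have hi2 := hi.comp_add_right (conj β)
  simp only [key] at hi2
  unfold gaussPair
  rw [← integral_add_right_eq_self _ (conj β)]
  simp only [key]
  rw [integral_entire_mul_gauss (by fun_prop) hi2]
  simp

/-- The square of the unnormalised Fock norm. -/
def gaussNormSq (f : ℂ → ℂ) : ℝ := ∫ z : ℂ, ‖f z‖ ^ 2 * Real.exp (-‖z‖ ^ 2)

/-- Reproducing property plus a weighted arithmetic-geometric inequality in place of Cauchy-Schwarz.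
The crude factor `gaussNormSq f + 1` suffices: only the exponent and uniformity on norm bounded
families matter later. -/
theorem norm_le_exp_of_isFock {f : ℂ → ℂ} (hf : IsFock f) (w : ℂ) :
    ‖f w‖ ≤ (gaussNormSq f + 1) * Real.exp (‖w‖ ^ 2 / 2) := by
  have hk := isFock_exp (conj w)
  have hpi := Real.pi_gt_three
  set e := Real.exp (‖w‖ ^ 2 / 2) with he
  have hepos : 0 < e := Real.exp_pos _
  have hrep := gaussPair_exp hf (conj w)
  rw [Complex.conj_conj] at hrep
  have hself : ∫ z : ℂ, ‖Complex.exp (conj w * z)‖ ^ 2 * Real.exp (-‖z‖ ^ 2) =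
      Real.pi * e ^ 2 := by
    have h := gaussPair_exp hk (conj w)
    have h2 : gaussPair (fun z => Complex.exp (conj w * z)) (fun z => Complex.exp (conj w * z)) =
        ((∫ z : ℂ, ‖Complex.exp (conj w * z)‖ ^ 2 * Real.exp (-‖z‖ ^ 2) : ℝ) : ℂ) := by
      unfold gaussPair
      rw [← integral_complex_ofReal]
      refine integral_congr_ae (Eventually.of_forall fun z => ?_)
      simp only [Complex.mul_conj, Complex.normSq_eq_norm_sq]
      push_cast
      ring
    rw [h2, Complex.conj_conj, mul_comm (conj w), Complex.mul_conj'] at h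
    have h3 : Complex.exp ((‖w‖ : ℂ) ^ 2) = ((e ^ 2 : ℝ) : ℂ) := by
      rw [he, ← Real.exp_nat_mul, Complex.ofReal_exp]
      congr 1
      push_cast
      ring
    rw [h3] at h
    exact_mod_cast h
  -- The kernel has squared norm `π e²`; the weights `e / 2` and `1 / (2e)` make both contributions
  -- linear in `e`.
  have h1 : ‖(Real.pi : ℂ) * f w‖ ≤
      ∫ z : ℂ, (e / 2 * (‖f z‖ ^ 2 * Real.exp (-‖z‖ ^ 2)) +
        (1 / (2 * e)) * (‖Complex.exp (conj w * z)‖ ^ 2 * Real.exp (-‖z‖ ^ 2))) := by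
    rw [← hrep]
    refine norm_integral_le_of_norm_le ((hf.2.const_mul _).add (hk.2.const_mul _))
      (Eventually.of_forall fun z => ?_)
    rw [norm_mul, norm_mul, norm_exp_neg_sq, RCLike.norm_conj, ← mul_assoc, ← mul_assoc, ← add_mul]
    refine mul_le_mul_of_nonneg_right ?_ (Real.exp_pos _).le
    set y := ‖Complex.exp (conj w * z)‖
    have h3 : e / 2 * ‖f z‖ ^ 2 + 1 / (2 * e) * y ^ 2 - ‖f z‖ * y =
        (e * ‖f z‖ - y) ^ 2 / (2 * e) := by
      field_simp
      ring
    have h4 : 0 ≤ (e * ‖f z‖ - y) ^ 2 / (2 * e) := by positivity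
    linarith
  rw [integral_add (hf.2.const_mul _) (hk.2.const_mul _), integral_const_mul, integral_const_mul,
    hself, norm_mul, Complex.norm_real, Real.norm_of_nonneg Real.pi_pos.le] at h1
  change _ ≤ e / 2 * gaussNormSq f + _ at h1
  have h5 : 1 / (2 * e) * (Real.pi * e ^ 2) = Real.pi * (e / 2) := by
    field_simp
  rw [h5] at h1
  have h6 : 0 ≤ gaussNormSq f := integral_nonneg fun z => by positivity
  have h7 : Real.pi * ‖f w‖ ≤ Real.pi * ((gaussNormSq f + 1) * e) := by
    refine h1.trans ?_
    nlinarith [mul_nonneg h6 hepos.le, Real.pi_pos]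
  exact le_of_mul_le_mul_left h7 Real.pi_pos

/-! ### Coefficient comparison and generating functions of pairings. -/

theorem powerSeries_coeff_unique {c d : ℕ → ℂ} {F : ℂ → ℂ}
    (hc : ∀ t, HasSum (fun n => t ^ n * c n) (F t))
    (hd : ∀ t, HasSum (fun n => t ^ n * d n) (F t)) (n : ℕ) : c n = d n := by
  have key : ∀ e : ℕ → ℂ, (∀ t, HasSum (fun n => t ^ n * e n) (F t)) →
      HasFPowerSeriesAt F (FormalMultilinearSeries.ofScalars ℂ e) 0 := by
    intro e he
    rw [hasFPowerSeriesAt_iff]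
    refine Eventually.of_forall fun t => ?_
    simpa [FormalMultilinearSeries.coeff_ofScalars] using he t
  have h := (key c hc).eq_formalMultilinearSeries (key d hd)
  have h2 := congrArg (fun p => FormalMultilinearSeries.coeff p n) h
  simpa [FormalMultilinearSeries.coeff_ofScalars] using h2

/-- Comparison of coefficients when one of the series has a factor `t ^ m`. -/
theorem powerSeries_coeff_shift {x y : ℕ → ℂ} {F G : ℂ → ℂ} (m : ℕ)
    (hx : ∀ t, HasSum (fun n => t ^ n * x n) (F t))
    (hy : ∀ t, HasSum (fun n => t ^ n * y n) (G t)) (h : ∀ t, F t = t ^ m * G t) :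
    (∀ n < m, x n = 0) ∧ ∀ j, x (m + j) = y j := by
  have hz : ∀ t, HasSum (fun n => t ^ n * (if m ≤ n then y (n - m) else 0)) (F t) := by
    intro t
    rw [h t, ← hasSum_nat_add_iff' m]
    have h0 : ∑ i ∈ Finset.range m, t ^ i * (if m ≤ i then y (i - m) else 0) = 0 :=
      Finset.sum_eq_zero fun i hi => by
        rw [if_neg (by simpa using hi), mul_zero]
    rw [h0, sub_zero]
    refine ((hy t).mul_left (t ^ m)).congr_fun ?_
    intro n
    simp
    ring
  have hu := powerSeries_coeff_unique hx hz
  refine ⟨fun n hn => ?_, fun j => ?_⟩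
  · rw [hu n, if_neg (by omega)]
  · rw [hu (m + j), if_pos (by omega), Nat.add_sub_cancel_left]

theorem hasSum_taylor_entire {f : ℂ → ℂ} (hf : Differentiable ℂ f) (q t : ℂ) :
    HasSum (fun n => t ^ n * (iteratedDeriv n f q / n.factorial)) (f (q + t)) := by
  have h := Complex.hasSum_taylorSeries_of_entire hf q (q + t)
  refine h.congr_fun fun n => ?_
  simp only [smul_eq_mul, add_sub_cancel_left]
  ring

/-- Expansion of the pairing with `exp (t (z - q)) exp (β z) (z - q) ^ m` in powers of `t`. -/
theorem hasSum_gaussPair_exp {u : ℂ → ℂ} (hu : IsFock u) (m : ℕ) (q β t : ℂ) :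
    HasSum (fun n => t ^ n * (gaussPair (fun z => (z - q) ^ (m + n) * Complex.exp (β * z)) u /
        n.factorial))
      (gaussPair (fun z => Complex.exp (t * (z - q)) * ((z - q) ^ m * Complex.exp (β * z))) u) := by
  have hn : ∀ (n : ℕ) (z : ℂ),
      ‖t ^ n / n.factorial * ((z - q) ^ (m + n) * Complex.exp (β * z))‖ =
      (‖t‖ * ‖z - q‖) ^ n / n.factorial * ‖(z - q) ^ m * Complex.exp (β * z)‖ := by
    intro n z
    simp only [norm_mul, norm_div, norm_pow, RCLike.norm_natCast]
    ring
  have hs : ∀ z, HasSum (fun n => ‖t ^ n / n.factorial *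
      ((z - q) ^ (m + n) * Complex.exp (β * z))‖)
      (Real.exp (‖t‖ * ‖z - q‖) * ‖(z - q) ^ m * Complex.exp (β * z)‖) := by
    intro z
    simp only [hn]
    refine HasSum.mul_right _ ?_
    rw [Real.exp_eq_exp_ℝ]
    exact NormedSpace.expSeries_div_hasSum_exp _
  have h := hasSum_gaussPair (u := u)
    (h := fun n z => t ^ n / n.factorial * ((z - q) ^ (m + n) * Complex.exp (β * z)))
    (H := fun z => Complex.exp (t * (z - q)) * ((z - q) ^ m * Complex.exp (β * z)))
    hu (fun n => by fun_prop) (fun z => (hs z).summable) ?_ fun z => ?_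
  · refine h.congr_fun fun n => ?_
    rw [gaussPair_const_mul]
    ring
  · refine (gaussBound_exp (K := m.factorial) (s := 0) (τ := ‖t‖ + 1 + ‖β‖)
      (κ := ‖t‖ * ‖q‖ + ‖q‖) (by positivity) (by norm_num)).mono fun z => ?_
    rw [(hs z).tsum_eq, norm_mul, norm_pow, Complex.norm_exp]
    have h1 : ‖z - q‖ ^ m ≤ m.factorial * Real.exp ‖z - q‖ := by
      have := Real.pow_div_factorial_le_exp ‖z - q‖ (norm_nonneg _) m
      rw [div_le_iff₀ (by positivity)] at this
      linarith
    have h2 : (β * z).re ≤ ‖β‖ * ‖z‖ := (Complex.re_le_norm _).trans (norm_mul _ _).le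
    have h3 := norm_sub_le z q
    have h4 := mul_le_mul_of_nonneg_left h3 (norm_nonneg t)
    calc Real.exp (‖t‖ * ‖z - q‖) * (‖z - q‖ ^ m * Real.exp (β * z).re)
        ≤ Real.exp (‖t‖ * ‖z - q‖) * ((m.factorial * Real.exp ‖z - q‖) *
            Real.exp (‖β‖ * ‖z‖)) := by gcongr
      _ = m.factorial * Real.exp (‖t‖ * ‖z - q‖ + ‖z - q‖ + ‖β‖ * ‖z‖) := by
        rw [Real.exp_add, Real.exp_add]
        ring
      _ ≤ _ := mul_le_mul_of_nonneg_left (Real.exp_le_exp.mpr (by linarith)) (by positivity)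
  · have h1 : HasSum (fun n : ℕ => (t * (z - q)) ^ n / n.factorial)
        (Complex.exp (t * (z - q))) := by
      rw [Complex.exp_eq_exp_ℂ]
      exact NormedSpace.expSeries_div_hasSum_exp _
    refine (h1.mul_right ((z - q) ^ m * Complex.exp (β * z))).congr_fun fun n => ?_
    rw [mul_pow]
    ring

theorem gaussPair_exp_left {v : ℂ → ℂ} (hv : IsFock v) (β : ℂ) :
    gaussPair (fun z => Complex.exp (β * z)) v = Real.pi * conj (v (conj β)) := by
  rw [← gaussPair_conj, gaussPair_exp hv, map_mul, Complex.conj_ofReal]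

/-- The derivatives of the kernel functions reproduce the derivatives. -/
theorem gaussPair_pow_mul_exp {v : ℂ → ℂ} (hv : IsFock v) (n : ℕ) (β : ℂ) :
    gaussPair (fun z => z ^ n * Complex.exp (β * z)) v =
      Real.pi * conj (iteratedDeriv n v (conj β)) := by
  have h1 := hasSum_gaussPair_exp hv 0 0 β
  simp only [sub_zero, pow_zero, one_mul, zero_add, ← Complex.exp_add, ← add_mul,
    gaussPair_exp_left hv] at h1
  -- Moving the exponent from `β` to `β + t` turns the reproducing formula into a Taylor expansion
  -- of `v` at `conj β`; the coefficients in `t` are then compared.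
  have h2 : ∀ t : ℂ, HasSum (fun n => t ^ n * ((Real.pi *
      conj (iteratedDeriv n v (conj β))) / n.factorial)) (Real.pi * conj (v (conj (t + β)))) := by
    intro t
    have h3 := hasSum_taylor_entire hv.1 (conj β) (conj t)
    have h4 := ((h3.map (starRingEnd ℂ) Complex.continuous_conj).mul_left (Real.pi : ℂ))
    rw [map_add, add_comm (conj t)]
    refine h4.congr_fun fun n => ?_
    simp only [Function.comp_apply, map_mul, map_div₀, map_pow, Complex.conj_conj, map_natCast]
    ring
  have h := powerSeries_coeff_unique h1 h2 n
  have hf : (n.factorial : ℂ) ≠ 0 := by exact_mod_cast n.factorial_ne_zero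
  exact (div_left_inj' hf).mp h

theorem gaussPair_sum {ι : Type*} (s : Finset ι) {f : ι → ℂ → ℂ} {g : ℂ → ℂ}
    (hf : ∀ i ∈ s, IsFock (f i)) (hg : IsFock g) :
    gaussPair (fun z => ∑ i ∈ s, f i z) g = ∑ i ∈ s, gaussPair (f i) g := by
  unfold gaussPair
  rw [← integral_finsetSum s fun i hi => (hf i hi).integrable_mul hg]
  simp only [Finset.sum_mul]

theorem gaussPair_sub_pow_mul_exp {v : ℂ → ℂ} (hv : IsFock v) (m : ℕ) (b β : ℂ) :
    gaussPair (fun z => (z - conj b) ^ m * Complex.exp (β * z)) v =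
      Real.pi * conj (∑ j ∈ Finset.range (m + 1),
        (m.choose j : ℂ) * (-b) ^ (m - j) * iteratedDeriv j v (conj β)) := by
  have h1 : (fun z => (z - conj b) ^ m * Complex.exp (β * z)) = fun z =>
      ∑ j ∈ Finset.range (m + 1),
        ((m.choose j : ℂ) * (-conj b) ^ (m - j)) * (z ^ j * Complex.exp (β * z)) := by
    funext z
    rw [sub_eq_add_neg, add_pow, Finset.sum_mul]
    exact Finset.sum_congr rfl fun j _ => by ring
  rw [h1, gaussPair_sum _ _ hv, map_sum, Finset.mul_sum]
  · refine Finset.sum_congr rfl fun j _ => ?_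
    rw [gaussPair_const_mul, gaussPair_pow_mul_exp hv]
    simp only [map_mul, map_pow, map_neg, map_natCast]
    ring
  · intro j _
    have := isFock_pow_mul_exp j 0 β
    simp only [sub_zero] at this
    exact this.smul _

/-! ### First inclusion: testing on exponentials. -/

/-- Since `conj b = conj a * (-b)`, every term carries the same factor `conj a ^ m`. What remains is
the binomial sum produced by pairing with `(z - conj b)^m e^{βz}`. -/
theorem sum_choose_conj {a b : ℂ} (hab : conj a * b + conj b = 0) (m : ℕ) (x : ℕ → ℂ) :
    ∑ j ∈ Finset.range (m + 1), (m.choose j : ℂ) * conj a ^ j * conj b ^ (m - j) * x j =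
      conj a ^ m * ∑ j ∈ Finset.range (m + 1), (m.choose j : ℂ) * (-b) ^ (m - j) * x j := by
  rw [Finset.mul_sum]
  refine Finset.sum_congr rfl fun j hj => ?_
  have hb : conj b = conj a * (-b) := by linear_combination hab
  have hj' : j ≤ m := Nat.lt_succ_iff.mp (Finset.mem_range.mp hj)
  rw [hb, mul_pow, ← pow_mul_pow_sub (conj a) hj']
  ring

theorem conj_mul_self_of_norm_eq_one {a : ℂ} (ha : ‖a‖ = 1) : conj a * a = 1 := by
  rw [Complex.conj_mul', ha]
  norm_num

/-- Membership in the graph of the binomial operator is a family of scalar equations on pairings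
with exponential functions. -/
theorem binom_relation_iff {a b : ℂ} (ha : ‖a‖ = 1) (hab : conj a * b + conj b = 0)
    (A B C D : ℂ) (m : ℕ) {u v : ℂ → ℂ} (hu : IsFock u) (hv : IsFock v) (β : ℂ) :
    gaussPair (fun z => C * conj a ^ m * Complex.exp (B * β) * Complex.exp ((D + A * β) * z)) u =
        gaussPair (fun w => (D + A * β) ^ m * ((w - conj b) ^ m * Complex.exp (β * w))) v ↔
      conj C * Complex.exp (conj B * conj β) * u (conj A * conj β + conj D) =
        (conj A * conj β + conj D) ^ m * ∑ j ∈ Finset.range (m + 1),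
          (m.choose j : ℂ) * conj a ^ j * conj b ^ (m - j) * iteratedDeriv j v (conj β) := by
  have haa := conj_mul_self_of_norm_eq_one ha
  have ham : conj a ^ m * a ^ m = 1 := by rw [← mul_pow, haa, one_pow]
  have ham0 : conj a ^ m ≠ 0 := left_ne_zero_of_mul_eq_one ham
  rw [gaussPair_const_mul, gaussPair_const_mul, gaussPair_exp_left hu,
    gaussPair_sub_pow_mul_exp hv, sum_choose_conj hab, ← (starRingEnd ℂ).injective.eq_iff]
  have hpi : (Real.pi : ℂ) ≠ 0 := by exact_mod_cast Real.pi_ne_zero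
  simp only [map_mul, map_pow, Complex.conj_conj, Complex.conj_ofReal, ← Complex.exp_conj,
    map_add]
  set S := ∑ j ∈ Finset.range (m + 1), (m.choose j : ℂ) * (-b) ^ (m - j) *
    iteratedDeriv j v (conj β)
  rw [add_comm (conj D)]
  constructor
  · intro h
    have h2 := mul_left_cancel₀ hpi (a := (Real.pi : ℂ))
      (b := conj C * a ^ m * Complex.exp (conj B * conj β) * u (conj A * conj β + conj D))
      (c := (conj A * conj β + conj D) ^ m * S) (by linear_combination h)
    linear_combination conj a ^ m * h2 - conj C * Complex.exp (conj B * conj β) *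
      u (conj A * conj β + conj D) * ham
  · intro h
    linear_combination Real.pi * a ^ m * h + Real.pi * (conj A * conj β + conj D) ^ m * S * ham

theorem iteratedDeriv_const_mul_exp (c l : ℂ) (m : ℕ) (z : ℂ) :
    iteratedDeriv m (fun z => c * Complex.exp (l * z)) z = c * (l ^ m * Complex.exp (l * z)) := by
  rw [iteratedDeriv_const_mul_field, iteratedDeriv_cexp_const_mul]

/-- The hypotheses give `b = -a conj b`, so in the variable `Az + B` the symbol vanishes at `conj
b`, the centre of the test functions. -/
theorem symbol_eq {a b : ℂ} (ha : ‖a‖ = 1) (hab : conj a * b + conj b = 0) (A B z : ℂ) :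
    a * A * z + a * B + b = a * (A * z + B - conj b) := by
  have haa := conj_mul_self_of_norm_eq_one ha
  linear_combination a * hab - b * haa

/-- For each point `z` a single graph pair suffices, the one with `β = conj z`. The factor `conj a ^
m` in its second component cancels the `a ^ m` of the symbol. -/
theorem adjoint_maxMultiWCO_le {a b : ℂ} (ha : ‖a‖ = 1) (hab : conj a * b + conj b = 0)
    (A B C D : ℂ) (m : ℕ) :
    (maxMultiWCO (fun z => C * Complex.exp (D * z)) (fun z => A * z + B)
        (fun z => (a * A * z + a * B + b) ^ m) m).adjoint ≤
      maxMultiWCOBinom (fun z => conj C * Complex.exp (conj B * z))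
        (fun z => conj A * z + conj D) (fun z => (conj A * z + conj D) ^ m) m
        (conj a) (conj b) := by
  rintro ⟨u, v⟩ h z
  rw [MultiOp.mem_adjoint_iff] at h
  have haa := conj_mul_self_of_norm_eq_one ha
  have ham : conj a ^ m * a ^ m = 1 := by rw [← mul_pow, haa, one_pow]
  have hiff := binom_relation_iff ha hab A B C D m u.isFock v.isFock (conj z)
  rw [Complex.conj_conj] at hiff
  refine hiff.mp ?_
  set β := conj z
  have hg : IsFock (fun z => C * conj a ^ m * Complex.exp (B * β) *
      Complex.exp ((D + A * β) * z)) := (isFock_exp (D + A * β)).smul _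
  have hf : IsFock (fun w => (D + A * β) ^ m * ((w - conj b) ^ m * Complex.exp (β * w))) :=
    (isFock_pow_mul_exp m (conj b) β).smul _
  refine (FockSpace.pairing_eq_iff ⟨_, hf⟩ ⟨_, hg⟩ u v).mp (h _ _ fun y => ?_)
  change C * Complex.exp (D * y) * ((D + A * β) ^ m * ((A * y + B - conj b) ^ m *
    Complex.exp (β * (A * y + B)))) = (a * A * y + a * B + b) ^ m * iteratedDeriv m
      (fun z => C * conj a ^ m * Complex.exp (B * β) * Complex.exp ((D + A * β) * z)) y
  rw [iteratedDeriv_const_mul_exp, symbol_eq ha hab, mul_pow]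
  have he : Complex.exp (D * y) * Complex.exp (β * (A * y + B)) =
      Complex.exp (B * β) * Complex.exp ((D + A * β) * y) := by
    rw [← Complex.exp_add, ← Complex.exp_add]
    congr 1
    ring
  linear_combination C * (D + A * β) ^ m * (A * y + B - conj b) ^ m * he -
    C * (D + A * β) ^ m * (A * y + B - conj b) ^ m * Complex.exp (B * β) *
      Complex.exp ((D + A * β) * y) * ham

/-! ### Dilations -/

/-- Contraction towards `q` by the factor `r`, with an exponential correction. -/
def dilate (q δ : ℂ) (r : ℝ) (f : ℂ → ℂ) (w : ℂ) : ℂ :=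
  Complex.exp (-(δ * (1 - r) * (w - q))) * f (q + r * (w - q))

/-- The change in the Gaussian exponent is at most `(1 - r)(2(‖q‖ + ‖δ‖)‖η‖ - ‖η‖²)` with `η = w -
q`, hence at most `(‖q‖ + ‖δ‖)²`. The factor `4` bounds the Jacobian `r⁻²` for `r ≥ 1/2`. Uniformity
in `r` is what the weak limit needs. -/
theorem isFock_dilate_and_bound {f : ℂ → ℂ} (hf : IsFock f) (q δ : ℂ) {r : ℝ} (hr : 1 / 2 ≤ r)
    (hr1 : r < 1) : IsFock (dilate q δ r f) ∧
      gaussNormSq (dilate q δ r f) ≤ 4 * Real.exp ((‖q‖ + ‖δ‖) ^ 2) * gaussNormSq f := by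
  have hd := hf.1
  have hr0 : (0 : ℝ) < r := by linarith
  have hdd : Differentiable ℂ (dilate q δ r f) := by
    unfold dilate
    fun_prop
  set G : ℂ → ℝ := fun z => ‖f z‖ ^ 2 * Real.exp (-‖z‖ ^ 2) with hG
  have hpt : ∀ w, ‖dilate q δ r f w‖ ^ 2 * Real.exp (-‖w‖ ^ 2) ≤
      Real.exp ((‖q‖ + ‖δ‖) ^ 2) * G (r • (w - q) + q) := by
    intro w
    have hreal : r • (w - q) + q = q + r * (w - q) := by rw [Complex.real_smul, add_comm]
    set η := w - q with hη
    have hw : w = q + η := by rw [hη]; ring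
    rw [hreal, hG]
    simp only [dilate, ← hη, norm_mul, Complex.norm_exp, mul_pow]
    rw [mul_left_comm (Real.exp ((‖q‖ + ‖δ‖) ^ 2)), mul_comm (Real.exp _ ^ 2), mul_assoc]
    refine mul_le_mul_of_nonneg_left ?_ (by positivity)
    rw [← Real.exp_nat_mul, ← Real.exp_add, ← Real.exp_add]
    refine Real.exp_le_exp.mpr ?_
    have h1 : (-(δ * (1 - r) * η)).re ≤ ‖δ‖ * (1 - r) * ‖η‖ := by
      refine (Complex.re_le_norm _).trans ?_
      rw [norm_neg, norm_mul, norm_mul, ← Complex.ofReal_one, ← Complex.ofReal_sub,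
        Complex.norm_real, Real.norm_of_nonneg (by linarith)]
    have h2 : ‖w‖ ^ 2 = ‖q‖ ^ 2 + 2 * (q * conj η).re + ‖η‖ ^ 2 := by
      rw [hw, ← Complex.normSq_eq_norm_sq, Complex.normSq_add, Complex.normSq_eq_norm_sq,
        Complex.normSq_eq_norm_sq]
      ring
    have h3 : ‖q + r * η‖ ^ 2 = ‖q‖ ^ 2 + 2 * r * (q * conj η).re + r ^ 2 * ‖η‖ ^ 2 := by
      rw [← Complex.normSq_eq_norm_sq, Complex.normSq_add, Complex.normSq_eq_norm_sq,
        Complex.normSq_mul, Complex.normSq_ofReal, Complex.normSq_eq_norm_sq, map_mul,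
        Complex.conj_ofReal, mul_left_comm, Complex.re_ofReal_mul]
      ring
    have h4 : -(q * conj η).re ≤ ‖q‖ * ‖η‖ := by
      refine (neg_le_abs _).trans ((Complex.abs_re_le_norm _).trans ?_)
      rw [norm_mul, RCLike.norm_conj]
    rw [h2, h3]
    have h5 : 0 ≤ 1 - r := by linarith
    have h6 := mul_le_mul_of_nonneg_left h4 h5
    have h7 : (1 - r) * (2 * (‖q‖ + ‖δ‖) * ‖η‖ - ‖η‖ ^ 2) ≤ (‖q‖ + ‖δ‖) ^ 2 := by
      have h8 : 2 * (‖q‖ + ‖δ‖) * ‖η‖ - ‖η‖ ^ 2 ≤ (‖q‖ + ‖δ‖) ^ 2 := by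
        nlinarith [sq_nonneg (‖q‖ + ‖δ‖ - ‖η‖)]
      refine (mul_le_mul_of_nonneg_left h8 h5).trans ?_
      nlinarith [sq_nonneg (‖q‖ + ‖δ‖)]
    push_cast
    nlinarith [mul_nonneg (mul_nonneg h5 hr0.le) (sq_nonneg ‖η‖)]
  have hGi : Integrable (fun w => G (r • (w - q) + q)) := by
    have h1 : Integrable (fun w => G (w + q)) := hf.2.comp_add_right q
    have h2 : Integrable (fun w => G (r • w + q)) := h1.comp_smul hr0.ne'
    exact h2.comp_sub_right q
  have hGint : ∫ w, G (r • (w - q) + q) = (r ^ 2)⁻¹ * gaussNormSq f := by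
    rw [integral_sub_right_eq_self (fun w => G (r • w + q)) q,
      Measure.integral_comp_smul volume (fun w => G (w + q)) r, integral_add_right_eq_self G q,
      Complex.finrank_real_complex, smul_eq_mul, abs_of_pos (by positivity)]
    rfl
  have hcont := hdd.continuous
  have hF : Integrable (fun w => ‖dilate q δ r f w‖ ^ 2 * Real.exp (-‖w‖ ^ 2)) := by
    refine (hGi.const_mul (Real.exp ((‖q‖ + ‖δ‖) ^ 2))).mono'
      (Continuous.aestronglyMeasurable (by fun_prop)) (Eventually.of_forall fun w => ?_)
    rw [Real.norm_of_nonneg (by positivity)]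
    exact hpt w
  refine ⟨⟨hdd, hF⟩, (integral_mono hF (hGi.const_mul _) hpt).trans ?_⟩
  rw [integral_const_mul, hGint]
  have hn : 0 ≤ gaussNormSq f := integral_nonneg fun z => by positivity
  have hr2 : (r ^ 2)⁻¹ ≤ 4 := by
    rw [inv_le_comm₀ (by positivity) (by norm_num)]
    nlinarith
  calc Real.exp ((‖q‖ + ‖δ‖) ^ 2) * ((r ^ 2)⁻¹ * gaussNormSq f)
      ≤ Real.exp ((‖q‖ + ‖δ‖) ^ 2) * (4 * gaussNormSq f) := by gcongr
    _ = _ := by ring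

/-! ### Weak convergence of the dilations. -/

theorem tendsto_integral_norm_gt {u : ℂ → ℂ} (hu : IsFock u) :
    Tendsto (fun n : ℕ => ∫ z, ({z : ℂ | (n : ℝ) < ‖z‖}).indicator
      (fun z => ‖u z‖ ^ 2 * Real.exp (-‖z‖ ^ 2)) z) atTop (𝓝 0) := by
  have huc := hu.1.continuous
  have hms : ∀ n : ℕ, MeasurableSet {z : ℂ | (n : ℝ) < ‖z‖} := fun n =>
    measurableSet_lt measurable_const measurable_norm
  have h := tendsto_integral_of_dominated_convergence
    (F := fun (n : ℕ) => ({z : ℂ | (n : ℝ) < ‖z‖}).indicator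
      (fun z => ‖u z‖ ^ 2 * Real.exp (-‖z‖ ^ 2))) (f := fun _ => 0) (μ := volume)
    (fun z => ‖u z‖ ^ 2 * Real.exp (-‖z‖ ^ 2))
    (fun n => (hu.2.indicator (hms n)).aestronglyMeasurable) hu.2
    (fun n => Eventually.of_forall fun z => ?_) (Eventually.of_forall fun z => ?_)
  · simpa using h
  · refine (norm_indicator_le_norm_self _ _).trans (le_of_eq ?_)
    rw [Real.norm_of_nonneg (by positivity)]
  · obtain ⟨N, hN⟩ := exists_nat_ge ‖z‖
    refine tendsto_const_nhds.congr' ?_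
    filter_upwards [eventually_ge_atTop N] with n hn
    rw [Set.indicator_of_notMem]
    have : (N : ℝ) ≤ n := by exact_mod_cast hn
    simp only [Set.mem_ofPred_eq, not_lt]
    linarith

/-- A norm bounded family in the Fock space that tends to zero pointwise tends to zero weakly. -/
theorem tendsto_gaussPair_zero_of_bounded {ι : Type*} {l : Filter ι} [l.IsCountablyGenerated]
    {d : ι → ℂ → ℂ} {u : ℂ → ℂ} {M : ℝ} (hM : 0 < M) (hu : IsFock u)
    (hd : ∀ᶠ i in l, IsFock (d i) ∧ gaussNormSq (d i) ≤ M)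
    (hlim : ∀ z, Tendsto (fun i => d i z) l (𝓝 0)) :
    Tendsto (fun i => gaussPair (d i) u) l (𝓝 0) := by
  have huc := hu.1.continuous
  rw [Metric.tendsto_nhds]
  intro ε hε
  -- Weight for `xy ≤ (t/2) x² + y²/(2t)` outside a large ball: the first part is at most `tM/2 =
  -- ε/4`, and the radius `n` is chosen so that the tail of `u` makes the second less than `ε/4`.
  -- Inside the ball dominated convergence gives another `ε/4`.
  set t := ε / (2 * M) with ht
  have htpos : 0 < t := by positivity
  obtain ⟨n, hn⟩ := ((tendsto_integral_norm_gt hu).eventually_lt_const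
    (show 0 < t * ε / 2 by positivity)).exists
  set B : Set ℂ := Metric.closedBall 0 n with hB
  have hBm : MeasurableSet B := Metric.isClosed_closedBall.measurableSet
  have hcompl : Bᶜ = {z : ℂ | (n : ℝ) < ‖z‖} := by
    ext z
    simp [hB]
  rw [← hcompl] at hn
  have hball : Tendsto (fun i => ∫ z, B.indicator
      (fun z => ‖d i z * conj (u z) * (Real.exp (-‖z‖ ^ 2) : ℂ)‖) z) l (𝓝 0) := by
    have hbi : Integrable (B.indicator fun z : ℂ =>
        (M + 1) * Real.exp (‖z‖ ^ 2 / 2) * ‖u z‖ * Real.exp (-‖z‖ ^ 2)) := by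
      rw [integrable_indicator_iff hBm]
      exact Continuous.continuousOn (by fun_prop) |>.integrableOn_compact
        (isCompact_closedBall _ _)
    have h := tendsto_integral_filter_of_dominated_convergence (μ := volume) (l := l)
      (F := fun i => B.indicator
        (fun z => ‖d i z * conj (u z) * (Real.exp (-‖z‖ ^ 2) : ℂ)‖)) (f := fun _ => (0 : ℝ))
      _ ?_ ?_ hbi ?_
    · simpa using h
    · filter_upwards [hd] with i hi
      exact ((hi.1.integrable_mul hu).norm.indicator hBm).aestronglyMeasurable
    · filter_upwards [hd] with i hi
      refine Eventually.of_forall fun z => ?_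
      rw [norm_indicator_eq_indicator_norm]
      refine Set.indicator_le_indicator ?_
      rw [norm_norm, norm_mul, norm_mul, norm_exp_neg_sq, RCLike.norm_conj]
      have h1 := norm_le_exp_of_isFock hi.1 z
      have h2 := hi.2
      gcongr
      exact h1.trans (by gcongr)
    · refine Eventually.of_forall fun z => ?_
      by_cases hz : z ∈ B
      · simp only [Set.indicator_of_mem hz]
        have := (((hlim z).mul_const (conj (u z))).mul_const (Real.exp (-‖z‖ ^ 2) : ℂ)).norm
        simpa using this
      · simp only [Set.indicator_of_notMem hz]
        exact tendsto_const_nhds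
  filter_upwards [hd, hball.eventually_lt_const (show 0 < ε / 4 by positivity)] with i hi hib
  rw [dist_zero_right]
  have hI1 := (hi.1.integrable_mul hu).norm.indicator hBm
  have hI2 := hi.1.2.const_mul (t / 2)
  have hI3 := (hu.2.indicator hBm.compl).const_mul (1 / (2 * t))
  have hle : ‖gaussPair (d i) u‖ ≤ _ := norm_integral_le_of_norm_le ((hI1.add hI2).add hI3)
    (Eventually.of_forall fun z => ?_)
  · refine hle.trans_lt ?_
    rw [integral_add' (hI1.add hI2) hI3, integral_add' hI1 hI2, integral_const_mul,
      integral_const_mul]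
    have h1 : t / 2 * gaussNormSq (d i) ≤ ε / 4 := by
      calc t / 2 * gaussNormSq (d i) ≤ t / 2 * M := by gcongr; exact hi.2
        _ = ε / 4 := by rw [ht]; field_simp; norm_num
    have h2 : 1 / (2 * t) * ∫ z, Bᶜ.indicator
        (fun z => ‖u z‖ ^ 2 * Real.exp (-‖z‖ ^ 2)) z < ε / 4 := by
      calc _ < 1 / (2 * t) * (t * ε / 2) := by gcongr
        _ = ε / 4 := by field_simp; norm_num
    unfold gaussNormSq at h1
    linarith
  · simp only [Pi.add_apply]
    by_cases hz : z ∈ B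
    · rw [Set.indicator_of_mem hz, Set.indicator_of_notMem (by simpa using hz)]
      have : 0 ≤ t / 2 * (‖d i z‖ ^ 2 * Real.exp (-‖z‖ ^ 2)) := by positivity
      linarith
    · rw [Set.indicator_of_notMem hz, Set.indicator_of_mem (by simpa using hz), norm_mul,
        norm_mul, norm_exp_neg_sq, RCLike.norm_conj, zero_add, ← mul_assoc, ← mul_assoc,
        ← add_mul]
      refine mul_le_mul_of_nonneg_right ?_ (Real.exp_pos _).le
      have h3 : t / 2 * ‖d i z‖ ^ 2 + 1 / (2 * t) * ‖u z‖ ^ 2 - ‖d i z‖ * ‖u z‖ =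
          (t * ‖d i z‖ - ‖u z‖) ^ 2 / (2 * t) := by
        field_simp
        ring
      have h4 : 0 ≤ (t * ‖d i z‖ - ‖u z‖) ^ 2 / (2 * t) := by positivity
      linarith

theorem gaussPair_sub {f g u : ℂ → ℂ} (hf : IsFock f) (hg : IsFock g) (hu : IsFock u) :
    gaussPair (f - g) u = gaussPair f u - gaussPair g u := by
  unfold gaussPair
  rw [← integral_sub (hf.integrable_mul hu) (hg.integrable_mul hu)]
  simp only [Pi.sub_apply, sub_mul]

theorem IsFock.sub {f g : ℂ → ℂ} (hf : IsFock f) (hg : IsFock g) : IsFock (f - g) :=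
  fockSubmodule.sub_mem hf hg

theorem gaussNormSq_sub_le {f g : ℂ → ℂ} (hf : IsFock f) (hg : IsFock g) :
    gaussNormSq (f - g) ≤ 2 * gaussNormSq f + 2 * gaussNormSq g := by
  unfold gaussNormSq
  rw [← integral_const_mul, ← integral_const_mul,
    ← integral_add (hf.2.const_mul 2) (hg.2.const_mul 2)]
  refine integral_mono (hf.sub hg).2 ((hf.2.const_mul 2).add (hg.2.const_mul 2)) fun z => ?_
  simp only [Pi.sub_apply]
  rw [← mul_assoc, ← mul_assoc, ← add_mul]
  refine mul_le_mul_of_nonneg_right ?_ (Real.exp_pos _).le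
  nlinarith [norm_sub_le (f z) (g z), sq_nonneg (‖f z‖ - ‖g z‖), norm_nonneg (f z - g z),
    norm_nonneg (f z), norm_nonneg (g z)]

theorem tendsto_gaussPair_dilate {f u : ℂ → ℂ} (hf : IsFock f) (hu : IsFock u) (q δ : ℂ) :
    Tendsto (fun r : ℝ => gaussPair (dilate q δ r f) u) (𝓝[<] 1) (𝓝 (gaussPair f u)) := by
  have hn : 0 ≤ gaussNormSq f := integral_nonneg fun z => by positivity
  have hev : ∀ᶠ r : ℝ in 𝓝[<] 1, 1 / 2 ≤ r ∧ r < 1 := by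
    filter_upwards [self_mem_nhdsWithin,
      mem_nhdsWithin_of_mem_nhds (eventually_ge_nhds (show (1 / 2 : ℝ) < 1 by norm_num))]
      with r h1 h2 using ⟨h2, h1⟩
  have h0 : Tendsto (fun r : ℝ => gaussPair (dilate q δ r f - f) u) (𝓝[<] 1) (𝓝 0) := by
    refine tendsto_gaussPair_zero_of_bounded
      (M := 2 * (4 * Real.exp ((‖q‖ + ‖δ‖) ^ 2) * gaussNormSq f) + 2 * gaussNormSq f + 1)
      (by positivity) hu ?_ fun z => ?_
    · filter_upwards [hev] with r hr
      obtain ⟨h1, h2⟩ := isFock_dilate_and_bound hf q δ hr.1 hr.2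
      refine ⟨h1.sub hf, (gaussNormSq_sub_le h1 hf).trans ?_⟩
      linarith
    · have hc := hf.1.continuous
      have h1 : Continuous fun r : ℝ => (dilate q δ r f - f) z := by
        simp only [Pi.sub_apply, dilate]
        fun_prop
      have h2 := h1.tendsto 1
      have h3 : (dilate q δ 1 f - f) z = 0 := by simp [dilate]
      rw [h3] at h2
      exact h2.mono_left nhdsWithin_le_nhds
  have h1 := h0.add_const (gaussPair f u)
  rw [zero_add] at h1
  refine h1.congr' ?_
  filter_upwards [hev] with r hr
  rw [gaussPair_sub (isFock_dilate_and_bound hf q δ hr.1 hr.2).1 hf hu, sub_add_cancel]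

/-! ### Taylor expansion of the dilations. -/

/-- Cauchy estimates for an entire function with the growth of the Fock space. -/
theorem norm_taylor_coeff_mul_pow_le {F : ℂ → ℂ} (hF : Differentiable ℂ F) {N τ : ℝ} {q : ℂ}
    (hb : ∀ η, ‖F (q + η)‖ ≤ N * Real.exp (τ * ‖η‖ + (‖q‖ + ‖η‖) ^ 2 / 2)) (n : ℕ) {R : ℝ}
    (hR : 0 ≤ R) : ‖iteratedDeriv n F q / n.factorial‖ * R ^ n ≤
      N * Real.exp (τ * R + (‖q‖ + R) ^ 2 / 2) := by
  rcases hR.eq_or_lt with rfl | hR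
  · rcases n with _ | n
    · simpa using hb 0
    · have h0 := (norm_nonneg _).trans (hb 0)
      simpa using h0
  · have h := Complex.norm_iteratedDeriv_le_of_forall_mem_sphere_norm_le (c := q) n hR
      hF.diffContOnCl (C := N * Real.exp (τ * R + (‖q‖ + R) ^ 2 / 2)) fun z hz => by
        have h1 := hb (z - q)
        rw [add_sub_cancel] at h1
        rwa [mem_sphere_iff_norm.mp hz] at h1
    have hf : (0 : ℝ) < n.factorial := by exact_mod_cast n.factorial_pos
    rw [le_div_iff₀ (by positivity)] at h
    rw [norm_div, RCLike.norm_natCast, div_mul_eq_mul_div, div_le_iff₀ hf]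
    linarith

/-- With `F(z) = e^{δ(z-q)} f(z)`, the dilation is `F(q + r(w-q)) e^{-δ(w-q)}`; the Taylor series of
`F` at `q` is paired termwise, which `r < 1` makes legitimate. -/
theorem hasSum_gaussPair_dilate {f u : ℂ → ℂ} (hf : IsFock f) (hu : IsFock u) (q δ : ℂ) {r : ℝ}
    (hr : 0 < r) (hr1 : r < 1) :
    HasSum (fun n => (r : ℂ) ^ n * (iteratedDeriv n (fun z => Complex.exp (δ * (z - q)) * f z) q /
      n.factorial) * gaussPair (fun z => (z - q) ^ n * Complex.exp (-(δ * (z - q)))) u)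
      (gaussPair (dilate q δ r f) u) := by
  have hd := hf.1
  set F : ℂ → ℂ := fun z => Complex.exp (δ * (z - q)) * f z with hFdef
  have hF : Differentiable ℂ F := by
    rw [hFdef]
    fun_prop
  set k : ℕ → ℂ := fun n => iteratedDeriv n F q / n.factorial with hk
  set N := gaussNormSq f + 1 with hN
  have hNpos : 0 ≤ N := by
    have : 0 ≤ gaussNormSq f := integral_nonneg fun z => by positivity
    linarith
  have hb : ∀ η, ‖F (q + η)‖ ≤ N * Real.exp (‖δ‖ * ‖η‖ + (‖q‖ + ‖η‖) ^ 2 / 2) := by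
    intro η
    simp only [hFdef, add_sub_cancel_left, norm_mul, Complex.norm_exp]
    have h1 := norm_le_exp_of_isFock hf (q + η)
    have h2 : (δ * η).re ≤ ‖δ‖ * ‖η‖ := (Complex.re_le_norm _).trans (norm_mul _ _).le
    have h3 := norm_add_le q η
    calc Real.exp (δ * η).re * ‖f (q + η)‖
        ≤ Real.exp (‖δ‖ * ‖η‖) * (N * Real.exp ((‖q‖ + ‖η‖) ^ 2 / 2)) := by
          gcongr
          exact h1.trans (by gcongr)
      _ = _ := by rw [Real.exp_add]; ring
  -- The factor `r^n` is split as `s^n s^n`: one half gives a geometric series, the other shrinks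
  -- the Cauchy radius to `s‖z - q‖`, so the Gaussian growth has rate `s² < 1`.
  set s := Real.sqrt r with hs
  have hs0 : 0 ≤ s := Real.sqrt_nonneg r
  have hss : s * s = r := Real.mul_self_sqrt hr.le
  have hs1 : s < 1 := by nlinarith
  have hterm : ∀ (n : ℕ) (z : ℂ),
      ‖(r : ℂ) ^ n * k n * ((z - q) ^ n * Complex.exp (-(δ * (z - q))))‖ ≤
      s ^ n * (N * Real.exp (2 * ‖δ‖ * ‖z - q‖ + (‖q‖ + s * ‖z - q‖) ^ 2 / 2)) := by
    intro n z
    set η := z - q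
    have h1 := norm_taylor_coeff_mul_pow_le hF hb n (R := s * ‖η‖) (by positivity)
    have h2 : (-(δ * η)).re ≤ ‖δ‖ * ‖η‖ := by
      refine (Complex.re_le_norm _).trans ?_
      rw [norm_neg, norm_mul]
    have h3 : ‖δ‖ * (s * ‖η‖) ≤ ‖δ‖ * ‖η‖ :=
      mul_le_mul_of_nonneg_left (mul_le_of_le_one_left (norm_nonneg _) hs1.le) (norm_nonneg _)
    rw [norm_mul, norm_mul, norm_mul, norm_pow, norm_pow, Complex.norm_real,
      Real.norm_of_nonneg hr.le, Complex.norm_exp, ← hss, mul_pow]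
    calc s ^ n * s ^ n * ‖k n‖ * (‖η‖ ^ n * Real.exp (-(δ * η)).re)
        = s ^ n * ((‖k n‖ * (s * ‖η‖) ^ n) * Real.exp (-(δ * η)).re) := by
          rw [mul_pow]
          ring
      _ ≤ s ^ n * ((N * Real.exp (‖δ‖ * (s * ‖η‖) + (‖q‖ + s * ‖η‖) ^ 2 / 2)) *
            Real.exp (‖δ‖ * ‖η‖)) := by gcongr
      _ = s ^ n * (N * Real.exp (‖δ‖ * (s * ‖η‖) + (‖q‖ + s * ‖η‖) ^ 2 / 2 + ‖δ‖ * ‖η‖)) := by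
          rw [Real.exp_add _ (‖δ‖ * ‖η‖)]
          ring
      _ ≤ _ := by
          refine mul_le_mul_of_nonneg_left (mul_le_mul_of_nonneg_left
            (Real.exp_le_exp.mpr ?_) hNpos) (by positivity)
          linarith
  have hgeo := hasSum_geometric_of_lt_one hs0 hs1
  have hsum : ∀ z : ℂ, Summable fun n =>
      ‖(r : ℂ) ^ n * k n * ((z - q) ^ n * Complex.exp (-(δ * (z - q))))‖ := fun z =>
    Summable.of_nonneg_of_le (fun _ => norm_nonneg _) (fun n => hterm n z)
      (hgeo.summable.mul_right _)
  have h := hasSum_gaussPair (u := u) (H := dilate q δ r f)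
    (h := fun n z => (r : ℂ) ^ n * k n * ((z - q) ^ n * Complex.exp (-(δ * (z - q))))) hu
    (fun n => by fun_prop) hsum ?_ fun z => ?_
  · refine h.congr_fun fun n => ?_
    rw [gaussPair_const_mul]
  · refine (gaussBound_exp (K := (1 - s)⁻¹ * N) (s := s ^ 2) (τ := 2 * ‖δ‖ + s * (‖q‖ + s * ‖q‖))
      (κ := 2 * ‖δ‖ * ‖q‖ + (‖q‖ + s * ‖q‖) ^ 2 / 2)
      (mul_nonneg (inv_nonneg.mpr (by linarith)) hNpos) (by nlinarith)).mono fun z => ?_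
    have h1 := (hsum z).tsum_le_tsum (fun n => hterm n z) (hgeo.summable.mul_right _)
    rw [(hgeo.mul_right _).tsum_eq, ← mul_assoc] at h1
    refine h1.trans (mul_le_mul_of_nonneg_left (Real.exp_le_exp.mpr ?_)
      (mul_nonneg (inv_nonneg.mpr (by linarith)) hNpos))
    have h2 := norm_sub_le z q
    have h3 : ‖q‖ + s * ‖z - q‖ ≤ (‖q‖ + s * ‖q‖) + s * ‖z‖ := by nlinarith
    have h4 : (‖q‖ + s * ‖z - q‖) ^ 2 ≤ ((‖q‖ + s * ‖q‖) + s * ‖z‖) ^ 2 := by gcongr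
    have h5 := mul_le_mul_of_nonneg_left h2 (norm_nonneg δ)
    nlinarith
  · have h1 := hasSum_taylor_entire hF q (r * (z - q))
    have h2 : dilate q δ r f z = F (q + r * (z - q)) * Complex.exp (-(δ * (z - q))) := by
      simp only [hFdef, dilate, add_sub_cancel_left]
      have h3 : Complex.exp (-(δ * (1 - r) * (z - q))) =
          Complex.exp (δ * (r * (z - q))) * Complex.exp (-(δ * (z - q))) := by
        rw [← Complex.exp_add]
        ring_nf
      rw [h3]
      ring
    rw [h2]
    refine (h1.mul_right _).congr_fun fun n => ?_
    rw [mul_pow]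
    ring

theorem iteratedDeriv_add_order (f : ℂ → ℂ) (m j : ℕ) :
    iteratedDeriv j (iteratedDeriv m f) = iteratedDeriv (m + j) f := by
  rw [iteratedDeriv_eq_iterate, iteratedDeriv_eq_iterate, iteratedDeriv_eq_iterate, add_comm m,
    Function.iterate_add_apply]

theorem differentiable_iteratedDeriv_entire {f : ℂ → ℂ} (hf : Differentiable ℂ f) (m : ℕ) :
    Differentiable ℂ (iteratedDeriv m f) :=
  (hf.contDiff (n := (m + 1 : ℕ))).differentiable_iteratedDeriv m (by exact_mod_cast m.lt_succ_self)

/-! ### Reverse inclusion: matching coefficients and moments. -/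

/-- Comparison of the Taylor coefficients of `f` and `g` for a pair in the graph. -/
theorem taylor_coeff_of_relation {A B C D a p q : ℂ} (hA : A ≠ 0) (hp : A * p + B = q) {m : ℕ}
    {f g : ℂ → ℂ} (hf : Differentiable ℂ f) (hg : Differentiable ℂ g)
    (h : ∀ z, C * Complex.exp (D * z) * f (A * z + B) =
      (a * (A * z + B - q)) ^ m * iteratedDeriv m g z) :
    (∀ n < m, C * Complex.exp (D * p) * A ^ n *
      (iteratedDeriv n (fun z => Complex.exp (D / A * (z - q)) * f z) q / n.factorial) = 0) ∧
    ∀ j, C * Complex.exp (D * p) * A ^ (m + j) *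
      (iteratedDeriv (m + j) (fun z => Complex.exp (D / A * (z - q)) * f z) q /
        (m + j).factorial) = a ^ m * A ^ m * (iteratedDeriv (m + j) g p / j.factorial) := by
  have hF : Differentiable ℂ (fun z => Complex.exp (D / A * (z - q)) * f z) := by fun_prop
  -- The relation is read at `z = p + t`, where `Az + B = q + At` and the symbol is `(aAt)^m`. The
  -- exponent `D / A` is the one for which `e^{Dz}` becomes `e^{Dp}` times the correction at `q +
  -- At`.
  refine powerSeries_coeff_shift (F := fun t => C * Complex.exp (D * p) *
      (Complex.exp (D / A * (q + A * t - q)) * f (q + A * t)))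
    (G := fun t => a ^ m * A ^ m * iteratedDeriv m g (p + t)) m (fun t => ?_) (fun t => ?_)
    fun t => ?_
  · refine ((hasSum_taylor_entire hF q (A * t)).mul_left (C * Complex.exp (D * p))).congr_fun
      fun n => ?_
    rw [mul_pow]
    ring
  · refine ((hasSum_taylor_entire (differentiable_iteratedDeriv_entire hg m) p t).mul_left
      (a ^ m * A ^ m)).congr_fun fun n => ?_
    rw [iteratedDeriv_add_order]
    ring
  · have h1 := h (p + t)
    have h2 : A * (p + t) + B = q + A * t := by linear_combination hp
    have h3 : Complex.exp (D * (p + t)) =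
        Complex.exp (D * p) * Complex.exp (D / A * (q + A * t - q)) := by
      rw [← Complex.exp_add]
      congr 1
      field_simp
      ring
    rw [h2, h3, add_sub_cancel_left, mul_pow, mul_pow] at h1
    simp only [add_sub_cancel_left]
    linear_combination h1

/-- The Taylor relation for `(f, g)` and the moment relation for `(u, v)` have reciprocal factors,
so the terms of the expansions of `⟨g, u⟩` and `⟨f, v⟩` agree one by one. -/
theorem maxMultiWCOBinom_le_adjoint_of_ne_zero {a b : ℂ} (ha : ‖a‖ = 1)
    (hab : conj a * b + conj b = 0) {A B C D : ℂ} (hC : C ≠ 0) (hA : A ≠ 0) (m : ℕ) :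
    maxMultiWCOBinom (fun z => conj C * Complex.exp (conj B * z))
        (fun z => conj A * z + conj D) (fun z => (conj A * z + conj D) ^ m) m
        (conj a) (conj b) ≤
      (maxMultiWCO (fun z => C * Complex.exp (D * z)) (fun z => A * z + B)
        (fun z => (a * A * z + a * B + b) ^ m) m).adjoint := by
  rintro ⟨u, v⟩ huv
  rw [MultiOp.mem_adjoint_iff]
  intro f g hfg
  rw [FockSpace.pairing_eq_iff]
  have haa := conj_mul_self_of_norm_eq_one ha
  have ham : conj a ^ m * a ^ m = 1 := by rw [← mul_pow, haa, one_pow]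
  have ham0 : conj a ^ m ≠ 0 := left_ne_zero_of_mul_eq_one ham
  set q := conj b with hq
  set p := (q - B) / A with hpdef
  set δ := D / A with hδ
  have hp : A * p + B = q := by
    rw [hpdef]
    field_simp
    ring
  have hS : ∀ z, C * Complex.exp (D * z) * f (A * z + B) =
      (a * (A * z + B - q)) ^ m * iteratedDeriv m g z := by
    intro z
    have := hfg z
    simp only [symbol_eq ha hab] at this
    exact this
  obtain ⟨hk0, hk1⟩ := taylor_coeff_of_relation hA hp f.isFock.1 g.isFock.1 hS
  set E : ℕ → ℂ := fun n => gaussPair (fun z => (z - p) ^ n) u with hE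
  set P : ℕ → ℂ := fun n => gaussPair (fun z => (z - q) ^ n * Complex.exp (-δ * z)) v with hP
  set c₁ := C * conj a ^ m * Complex.exp (-(B * δ)) with hc₁
  have hc₁0 : c₁ ≠ 0 := mul_ne_zero (mul_ne_zero hC ham0) (Complex.exp_ne_zero _)
  -- The scalar equations are reparametrised by `s = D + Aβ` and recentred at `p` and `q`. Both
  -- sides shed the same factor `e^{sq/A}`, since `Ap + B = q`, and `c₁` is the constant left over.
  -- The trivial factors with exponent `0` only match the shape of `hasSum_gaussPair_exp`.
  have hpair : ∀ s : ℂ, c₁ * gaussPair (fun z => Complex.exp (s * (z - p)) *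
      ((z - p) ^ 0 * Complex.exp (0 * z))) u = s ^ m * gaussPair (fun z =>
        Complex.exp (s / A * (z - q)) * ((z - q) ^ m * Complex.exp (-δ * z))) v := by
    intro s
    have h1 := (binom_relation_iff ha hab A B C D m u.isFock v.isFock ((s - D) / A)).mpr (huv _)
    have hs : D + A * ((s - D) / A) = s := by
      field_simp
      ring
    rw [hs] at h1
    have h2 : (fun z => C * conj a ^ m * Complex.exp (B * ((s - D) / A)) * Complex.exp (s * z)) =
        fun z => (Complex.exp (s / A * q) * c₁) * (Complex.exp (s * (z - p)) *
          ((z - p) ^ 0 * Complex.exp (0 * z))) := by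
      funext z
      have h3 : Complex.exp (B * ((s - D) / A)) * Complex.exp (s * z) =
          Complex.exp (s / A * q) * Complex.exp (-(B * δ)) * Complex.exp (s * (z - p)) := by
        rw [← Complex.exp_add, ← Complex.exp_add, ← Complex.exp_add]
        congr 1
        rw [hpdef, hδ]
        field_simp
        ring
      rw [hc₁, zero_mul, Complex.exp_zero]
      linear_combination C * conj a ^ m * h3
    have h4 : (fun w => s ^ m * ((w - q) ^ m * Complex.exp ((s - D) / A * w))) =
        fun w => (Complex.exp (s / A * q) * s ^ m) * (Complex.exp (s / A * (w - q)) *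
          ((w - q) ^ m * Complex.exp (-δ * w))) := by
      funext w
      have h5 : Complex.exp ((s - D) / A * w) = Complex.exp (s / A * q) *
          Complex.exp (s / A * (w - q)) * Complex.exp (-δ * w) := by
        rw [← Complex.exp_add, ← Complex.exp_add]
        congr 1
        rw [hδ]
        field_simp
        ring
      rw [h5]
      ring
    rw [h2, h4, gaussPair_const_mul, gaussPair_const_mul] at h1
    refine mul_left_cancel₀ (Complex.exp_ne_zero (s / A * q)) ?_
    linear_combination h1
  obtain ⟨hE0, hE1⟩ := powerSeries_coeff_shift (x := fun n => c₁ * (E n / n.factorial))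
    (y := fun j => (A ^ j)⁻¹ * (P (m + j) / j.factorial))
    (G := fun s => gaussPair (fun z =>
        Complex.exp (s / A * (z - q)) * ((z - q) ^ m * Complex.exp (-δ * z))) v) m
    (fun t => ((hasSum_gaussPair_exp u.isFock 0 p 0 t).mul_left c₁).congr_fun fun n => by
      simp only [hE, zero_mul, Complex.exp_zero, mul_one, zero_add]
      ring)
    (fun t => (hasSum_gaussPair_exp v.isFock m q (-δ) (t / A)).congr_fun fun n => by
      simp only [hP, div_pow]
      ring) hpair
  have hterm : ∀ n, (iteratedDeriv n (fun z => Complex.exp (0 * (z - p)) * g z) p / n.factorial) *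
      gaussPair (fun z => (z - p) ^ n * Complex.exp (-(0 * (z - p)))) u =
      (iteratedDeriv n (fun z => Complex.exp (δ * (z - q)) * f z) q / n.factorial) *
      gaussPair (fun z => (z - q) ^ n * Complex.exp (-(δ * (z - q)))) v := by
    intro n
    have h1 : gaussPair (fun z => (z - q) ^ n * Complex.exp (-(δ * (z - q)))) v =
        Complex.exp (δ * q) * P n := by
      rw [hP, ← gaussPair_const_mul]
      congr 1
      funext z
      have : Complex.exp (-(δ * (z - q))) = Complex.exp (δ * q) * Complex.exp (-δ * z) := by
        rw [← Complex.exp_add]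
        congr 1
        ring
      rw [this]
      ring
    rw [h1]
    simp only [zero_mul, neg_zero, Complex.exp_zero, mul_one, one_mul]
    change _ * E n = _
    set k := iteratedDeriv n (fun z => Complex.exp (δ * (z - q)) * f z) q / n.factorial with hk
    have hDp0 : C * Complex.exp (D * p) * A ^ n ≠ 0 :=
      mul_ne_zero (mul_ne_zero hC (Complex.exp_ne_zero _)) (pow_ne_zero _ hA)
    have hfac : (n.factorial : ℂ) ≠ 0 := by exact_mod_cast n.factorial_ne_zero
    rcases lt_or_ge n m with hn | hn
    -- Below order `m` the derivatives of `g` and the moments of `v` are unconstrained, but they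
    -- meet the vanishing moments of `u` and coefficients of `f`.
    · have h2 : k = 0 := (mul_eq_zero.mp (hk0 n hn)).resolve_left hDp0
      have h3 : E n = 0 := by
        have := (mul_eq_zero.mp (hE0 n hn)).resolve_left hc₁0
        exact (div_eq_zero_iff.mp this).resolve_right hfac
      rw [h2, h3]
      ring
    · obtain ⟨j, rfl⟩ := Nat.exists_eq_add_of_le hn
      have hfj : (j.factorial : ℂ) ≠ 0 := by exact_mod_cast j.factorial_ne_zero
      have h2 := hk1 j
      have h3 := hE1 j
      have hAj : A ^ j ≠ 0 := pow_ne_zero _ hA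
      have h4 : P (m + j) = c₁ * (E (m + j) / (m + j).factorial) * (A ^ j * j.factorial) := by
        rw [h3]
        field_simp
      apply mul_left_cancel₀ hDp0
      have h5 : Complex.exp (D * p) = Complex.exp (-(B * δ)) * Complex.exp (δ * q) := by
        rw [← Complex.exp_add]
        congr 1
        rw [hpdef, hδ]
        field_simp
        ring
      calc _ = C * Complex.exp (D * p) * A ^ (m + j) *
            (iteratedDeriv (m + j) g p / (m + j).factorial * E (m + j)) := rfl
        _ = (conj a ^ m * a ^ m) * (C * Complex.exp (D * p) * A ^ (m + j) *
            (iteratedDeriv (m + j) g p / (m + j).factorial * E (m + j))) := by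
          rw [ham, one_mul]
        _ = (a ^ m * A ^ m * (iteratedDeriv (m + j) g p / j.factorial)) *
            (Complex.exp (δ * q) * P (m + j)) := by
          rw [h4, hc₁, h5, pow_add]
          field_simp
        _ = _ := by
          rw [← h2]
          ring
  -- The same ratio `r` on both sides multiplies equal terms by the same `r^n`, so the dilated
  -- pairings coincide before the limit.
  have hdil : ∀ᶠ r : ℝ in 𝓝[<] 1,
      gaussPair (dilate p 0 r g) u = gaussPair (dilate q δ r f) v := by
    filter_upwards [self_mem_nhdsWithin,
      mem_nhdsWithin_of_mem_nhds (eventually_gt_nhds (show (0 : ℝ) < 1 by norm_num))]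
      with r hr1 hr0
    refine (hasSum_gaussPair_dilate g.isFock u.isFock p 0 hr0 hr1).unique ?_
    refine (hasSum_gaussPair_dilate f.isFock v.isFock q δ hr0 hr1).congr_fun fun n => ?_
    rw [mul_assoc, hterm n, ← mul_assoc]
  exact tendsto_nhds_unique_of_eventuallyEq
    (tendsto_gaussPair_dilate g.isFock u.isFock p 0)
    (tendsto_gaussPair_dilate f.isFock v.isFock q δ) hdil

/-! ### The degenerate case and the conclusion. -/

/-- Both equations force an exponential: `g` is `C f(B) e^{Dz}` and `v` is `conj C u(conj D) e^{conj
B z}`. The reproducing property evaluates both pairings to `π C f(B) conj (u(conj D))`. -/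
theorem maxMultiWCOBinom_le_adjoint_constant (a b B C D : ℂ) :
    maxMultiWCOBinom (fun z => conj C * Complex.exp (conj B * z))
        (fun z => conj 0 * z + conj D) (fun z => (conj 0 * z + conj D) ^ 0) 0
        (conj a) (conj b) ≤
      (maxMultiWCO (fun z => C * Complex.exp (D * z)) (fun z => 0 * z + B)
        (fun z => (a * 0 * z + a * B + b) ^ 0) 0).adjoint := by
  rintro ⟨u, v⟩ huv
  rw [MultiOp.mem_adjoint_iff]
  intro f g hfg
  rw [FockSpace.pairing_eq_iff]
  have hg : (g : ℂ → ℂ) = fun z => (C * f B) * Complex.exp (D * z) := by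
    funext z
    have h := hfg z
    simp only [zero_mul, zero_add, pow_zero, one_mul, _root_.iteratedDeriv_zero] at h
    rw [← h]
    ring
  have hv : (v : ℂ → ℂ) = fun z => (conj C * u (conj D)) * Complex.exp (conj B * z) := by
    funext z
    have h := huv z
    simp only [map_zero, zero_mul, zero_add, pow_zero, one_mul, Finset.range_one,
      Finset.sum_singleton, Nat.choose_self, Nat.cast_one, Nat.sub_self,
      _root_.iteratedDeriv_zero] at h
    rw [← h]
    ring
  rw [← gaussPair_conj v f, hv, hg, gaussPair_const_mul, gaussPair_const_mul,
    gaussPair_exp_left u.isFock, gaussPair_exp_left f.isFock]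
  simp only [map_mul, Complex.conj_conj, Complex.conj_ofReal]
  ring

end

theorem mainTheorem3 (m : ℕ) (a b c A B C D : ℂ)
    (ha : ‖a‖ = 1) (hab : conj a * b + conj b = 0)
    (hc : ‖c‖ ^ 2 * Real.exp (‖b‖ ^ 2) = 1)
    (hC : C ≠ 0) (hA : A ≠ 0 ∨ m = 0) :
    (maxMultiWCO (fun z => C * Complex.exp (D * z)) (fun z => A * z + B)
        (fun z => (a * A * z + a * B + b) ^ m) m).adjoint =
      maxMultiWCOBinom (fun z => conj C * Complex.exp (conj B * z))
        (fun z => conj A * z + conj D) (fun z => (conj A * z + conj D) ^ m) m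
        (conj a) (conj b) := by
  refine le_antisymm (adjoint_maxMultiWCO_le ha hab A B C D m) ?_
  by_cases hA0 : A = 0
  · obtain rfl := hA.resolve_left (not_not.mpr hA0)
    subst hA0
    exact maxMultiWCOBinom_le_adjoint_constant a b B C D
  · exact maxMultiWCOBinom_le_adjoint_of_ne_zero ha hab hC hA0 m
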